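/- Let $A$ be a complex $C^*$-algebra, not necessarily unital. A linear map $d : A \to A$ is called a derivation if $d(ab) = d(a)b + a\,d(b)$ for all $a, b \in A$. Regard $A$ as a right module over itself by right multiplication; a linear map $\delta : A \to A$ is called a generalized derivation if there exists a derivation $d : A \to A$ such that $\delta(xa) = \delta(x)a + x\,d(a)$ for all $x, a \in A$. (Neither $\delta$ nor $d$ is assumed to be continuous.) Then every generalized derivation $\delta : A \to A$ is bounded, that is, there is a constant $C \ge 0$ such that $\|\delta(x)\| \le C\|x\|$ for all $x \in A$. -/

import Mathlib

/-- A derivation on a complex, not necessarily unital, algebra `A`: a linear map `d : A → A`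
with `d (a b) = d a b + a d b`. (Mathlib's `Derivation` is for commutative algebras only.)
No continuity is assumed. -/
def IsAlgDerivation {A : Type*} [NonUnitalRing A] [Module ℂ A] (d : A →ₗ[ℂ] A) : Prop :=
  ∀ a b : A, d (a * b) = d a * b + a * d b

/-- A generalized derivation on a right `A`-module `M`: a linear map `δ : M → M` for which there
is a derivation `d` on `A` with `δ (x a) = δ x a + x d a`. The right action `x a` is written
`MulOpposite.op a • x`, which is Mathlib's encoding of right actions. Neither `δ` nor `d` is
assumed to be continuous. -/
def IsGeneralizedDerivation (A : Type*) {M : Type*} [NonUnitalRing A] [Module ℂ A]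
    [AddCommGroup M] [Module ℂ M] [SMul Aᵐᵒᵖ M] (δ : M →ₗ[ℂ] M) : Prop :=
  ∃ d : A →ₗ[ℂ] A, IsAlgDerivation d ∧
    ∀ (x : M) (a : A),
      δ (MulOpposite.op a • x) = MulOpposite.op a • δ x + MulOpposite.op (d a) • x

/-- For `A` as a right module over itself, the action is right multiplication. -/
theorem isGeneralizedDerivation_self_iff {A : Type*} [NonUnitalRing A] [Module ℂ A]
    (δ : A →ₗ[ℂ] A) :
    IsGeneralizedDerivation A δ ↔
      ∃ d : A →ₗ[ℂ] A, (∀ a b : A, d (a * b) = d a * b + a * d b) ∧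
        ∀ x a : A, δ (x * a) = δ x * a + x * d a :=
  Iff.rfl

/-! ### Derivations are closable -/

section Derivation

variable {A : Type*} [NonUnitalCStarAlgebra A]

/-! If `d` is the derivation attached to `δ`, the Leibniz terms cancel in `δ - d`, which therefore
commutes with right multiplications. Both `d` and `δ - d` are bounded. For `d`: near the top of the
spectrum of a self-adjoint `x`, `‖x‖ - x` is a square `(√‖x‖ - k)²` whose root is almost killed by a
localizing `e`. By Leibniz `e * d x * e` is then negligible, so `‖x‖ ≤ ‖x + d x‖`. Applied to
multiples of `d`, this dissipativity makes `d` closable, and the closed graph theorem concludes. For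
a right module map `T`: if it were unbounded, small `u n` with `T (u n)` large would share a left
factor, `u n = b * c n` with `c n` bounded, while `T (u n) = T b * c n` stays bounded. -/

/-- Approximate spectral localization of a self-adjoint element `x` at the top `‖x‖` of its
quasispectrum. Formally, `k` is `√‖x‖ - √(‖x‖ - x)`. -/
theorem IsSelfAdjoint.exists_localization {x : A} (hx : IsSelfAdjoint x)
    (hM : ‖x‖ ∈ quasispectrum ℝ x) :
    ∃ k : A, x = (2 * √‖x‖) • k - k * k ∧ ∀ η : ℝ, 0 < η → η < ‖x‖ →
      ∃ e : A, ‖e‖ ≤ 1 ∧ ‖√‖x‖ • e - e * k‖ ≤ √η ∧ ‖√‖x‖ • e - k * e‖ ≤ √η ∧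
        ‖x‖ ≤ ‖e * x * e‖ := by
  have hle : ∀ s ∈ quasispectrum ℝ x, s ≤ ‖x‖ := fun s hs => (le_abs_self s).trans
    (NonUnitalIsometricContinuousFunctionalCalculus.norm_quasispectrum_le x hs hx)
  have hMnn := norm_nonneg x
  generalize ‖x‖ = M at hM hle hMnn ⊢
  have hgc : Continuous fun s => √M - √(M - s) := by fun_prop
  have hg0 : √M - √(M - 0) = 0 := by simp
  -- `√(M - s)` need not vanish at `0`; subtracting it from `√M` repairs this, so `k` lies in `A`
  -- without a unit.
  refine ⟨cfcₙ (fun s => √M - √(M - s)) x, ?_, fun η hη hηM => ?_⟩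
  · rw [← cfcₙ_mul _ _ x hgc.continuousOn hg0 hgc.continuousOn hg0,
      ← cfcₙ_const_mul _ _ x hgc.continuousOn hg0,
      ← cfcₙ_sub _ _ x (by fun_prop) (by simp) (by fun_prop) (by simp)]
    conv_lhs => rw [← cfcₙ_id' ℝ x]
    refine cfcₙ_congr fun s hs => ?_
    have h1 : √M * √M = M := Real.mul_self_sqrt hMnn
    have h2 : √(M - s) * √(M - s) = M - s := Real.mul_self_sqrt (by linarith [hle s hs])
    linear_combination h2 - h1
  -- A ramp supported within `η` of the top `M`, where `√(M - s) ≤ √η`; `η < M` gives `f 0 = 0`.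
  · obtain ⟨f, hfc, hf0, hfM, hfnn, hf1, hfz⟩ : ∃ f : ℝ → ℝ, Continuous f ∧ f 0 = 0 ∧ f M = 1 ∧
        (∀ s, 0 ≤ f s) ∧ (∀ s ≤ M, f s ≤ 1) ∧ ∀ s, η < M - s → f s = 0 := by
      refine ⟨fun s => max 0 (1 - (M - s) / η), by fun_prop, ?_, by simp, fun s => le_max_left _ _,
        fun s hs => max_le zero_le_one ?_, fun s hs => ?_⟩
      · simpa using (one_le_div hη).2 hηM.le
      · linarith [div_nonneg (sub_nonneg.2 hs) hη.le]
      · simpa using (one_le_div hη).2 hs.le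
    have hsmall : ‖cfcₙ (fun s => f s * √(M - s)) x‖ ≤ √η := by
      refine norm_cfcₙ_le fun s hs => ?_
      rw [Real.norm_of_nonneg (mul_nonneg (hfnn s) (Real.sqrt_nonneg _))]
      rcases le_or_gt (M - s) η with h | h
      · exact (mul_le_of_le_one_left (Real.sqrt_nonneg _) (hf1 s (hle s hs))).trans
          (Real.sqrt_le_sqrt h)
      · rw [hfz s h, zero_mul]; positivity
    refine ⟨cfcₙ f x, norm_cfcₙ_le fun s hs => ?_, ?_, ?_, ?_⟩
    · rw [Real.norm_of_nonneg (hfnn s)]; exact hf1 s (hle s hs)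
    · refine le_of_eq_of_le (congrArg _ ?_) hsmall
      rw [← cfcₙ_mul _ _ x hfc.continuousOn hf0 hgc.continuousOn hg0,
        ← cfcₙ_const_mul _ _ x hfc.continuousOn hf0,
        ← cfcₙ_sub _ _ x (by fun_prop) (by simp [hf0]) (by fun_prop) (by simp)]
      exact cfcₙ_congr fun s _ => by ring
    · refine le_of_eq_of_le (congrArg _ ?_) hsmall
      rw [← cfcₙ_mul _ _ x hgc.continuousOn hg0 hfc.continuousOn hf0,
        ← cfcₙ_const_mul _ _ x hfc.continuousOn hf0,
        ← cfcₙ_sub _ _ x (by fun_prop) (by simp [hf0]) (by fun_prop) (by simp)]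
      exact cfcₙ_congr fun s _ => by ring
    · have h1 : cfcₙ f x * x * cfcₙ f x = cfcₙ (fun s => f s * s * f s) x := by
        rw [cfcₙ_mul (fun s => f s * s) f x, cfcₙ_mul f (fun s => s) x, cfcₙ_id' ℝ x]
      have h2 := norm_apply_le_norm_cfcₙ (fun s => f s * s * f s) x hM
      rw [h1]
      simpa [hfM, abs_of_nonneg hMnn] using h2

/-- A derivation is dissipative at every self-adjoint element whose norm lies in the
quasispectrum. -/
theorem IsAlgDerivation.norm_le_norm_add_of_norm_mem {d : A →ₗ[ℂ] A} (hd : IsAlgDerivation d)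
    {x : A} (hx : IsSelfAdjoint x) (hM : ‖x‖ ∈ quasispectrum ℝ x) : ‖x‖ ≤ ‖x + d x‖ := by
  obtain hM0 | hMpos := (norm_nonneg x).eq_or_lt
  · rw [← hM0]; positivity
  obtain ⟨k, hxk, hk⟩ := hx.exists_localization hM
  have hdx : d x = (√‖x‖ • d k - k * d k) + (√‖x‖ • d k - d k * k) := by
    conv_lhs => rw [hxk]
    rw [map_sub, hd, LinearMap.map_smul_of_tower, two_mul, add_smul]
    abel
  have key : ∀ η : ℝ, 0 < η → η < ‖x‖ → ‖x‖ ≤ ‖x + d x‖ + 2 * ‖d k‖ * √η := by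
    intro η hη hηM
    obtain ⟨e, he1, hel, her, hexe⟩ := hk η hη hηM
    -- Each Leibniz term contains `√‖x‖ - k` next to one of the two `e`'s, hence a factor of norm at
    -- most `√η`.
    have hede : e * d x * e = (√‖x‖ • e - e * k) * d k * e + e * d k * (√‖x‖ • e - k * e) := by
      rw [hdx]
      simp only [mul_add, add_mul, mul_sub, sub_mul, smul_mul_assoc, mul_smul_comm, mul_assoc]
    have hmul : ∀ a b c : A, ‖a * b * c‖ ≤ ‖a‖ * ‖b‖ * ‖c‖ := fun a b c =>
      (norm_mul_le _ _).trans (by gcongr; exact norm_mul_le _ _)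
    have hedn : ‖e * d x * e‖ ≤ 2 * ‖d k‖ * √η := by
      rw [hede]
      calc _ ≤ √η * ‖d k‖ * 1 + 1 * ‖d k‖ * √η :=
            (norm_add_le _ _).trans (add_le_add ((hmul _ _ _).trans (by gcongr))
              ((hmul _ _ _).trans (by gcongr)))
        _ = _ := by ring
    have hcomp : ‖e * (x + d x) * e‖ ≤ ‖x + d x‖ := by
      calc _ ≤ 1 * ‖x + d x‖ * 1 := (hmul _ _ _).trans (by gcongr)
        _ = _ := by ring
    have hsplit : e * x * e = e * (x + d x) * e - e * d x * e := by noncomm_ring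
    calc ‖x‖ ≤ ‖e * x * e‖ := hexe
      _ ≤ ‖e * (x + d x) * e‖ + ‖e * d x * e‖ := by rw [hsplit]; exact norm_sub_le _ _
      _ ≤ _ := add_le_add hcomp hedn
  have hlim : Filter.Tendsto (fun η : ℝ => ‖x + d x‖ + 2 * ‖d k‖ * √η)
      (nhdsWithin 0 (Set.Ioi 0)) (nhds (‖x + d x‖)) := by
    have : Continuous (fun η : ℝ => ‖x + d x‖ + 2 * ‖d k‖ * √η) := by fun_prop
    simpa using (this.tendsto 0).mono_left nhdsWithin_le_nhds
  refine ge_of_tendsto hlim ?_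
  filter_upwards [Ioo_mem_nhdsGT hMpos] with η hη using key η hη.1 hη.2

/-- A derivation is dissipative at self-adjoint elements. -/
theorem IsAlgDerivation.norm_le_norm_add {d : A →ₗ[ℂ] A} (hd : IsAlgDerivation d)
    {x : A} (hx : IsSelfAdjoint x) : ‖x‖ ≤ ‖x + d x‖ := by
  obtain ⟨⟨s, hs, hsn⟩, -⟩ := NonUnitalIsometricContinuousFunctionalCalculus.isGreatest_norm_quasispectrum (𝕜 := ℝ) x hx
  simp only [Real.norm_eq_abs] at hsn
  rcases abs_choice s with h | h
  · exact hd.norm_le_norm_add_of_norm_mem hx (by rwa [← hsn, h])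
  · have hmem : ‖-x‖ ∈ quasispectrum ℝ (-x) := by
      rw [norm_neg, ← hsn, h, ← cfcₙ_neg_id (R := ℝ) x, cfcₙ_map_quasispectrum (fun s : ℝ => -s) x]
      exact ⟨s, hs, rfl⟩
    have := hd.norm_le_norm_add_of_norm_mem hx.neg hmem
    rwa [map_neg, ← neg_add, norm_neg, norm_neg] at this

theorem IsAlgDerivation.smul {d : A →ₗ[ℂ] A} (hd : IsAlgDerivation d) (z : ℂ) :
    IsAlgDerivation (z • d) := fun a b => by
  simp [hd a b, smul_mul_assoc, mul_smul_comm]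

theorem IsAlgDerivation.add {d d' : A →ₗ[ℂ] A} (hd : IsAlgDerivation d)
    (hd' : IsAlgDerivation d') : IsAlgDerivation (d + d') := fun a b => by
  simp only [LinearMap.add_apply, hd a b, hd' a b, add_mul, mul_add]
  abel

open Filter Topology in
/-- The restriction of a derivation to the self-adjoint part has no nonzero self-adjoint element in
its separating space. -/
theorem IsAlgDerivation.eq_zero_of_tendsto {d : A →ₗ[ℂ] A} (hd : IsAlgDerivation d)
    {u : ℕ → A} (hu : ∀ n, IsSelfAdjoint (u n)) (hu0 : Tendsto u atTop (𝓝 0)) {y : A}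
    (hy : IsSelfAdjoint y) (huy : Tendsto (fun n => d (u n)) atTop (𝓝 y)) : y = 0 := by
  -- Dissipativity of `t • d` at `t⁻¹ • u n - y`: in the limit `y` cancels on the right, leaving `-t
  -- • d y`.
  have key : ∀ t : ℝ, 0 < t → ‖y‖ ≤ t * ‖d y‖ := by
    intro t ht
    have h1 : ∀ n, ‖t⁻¹ • u n - y‖ ≤ ‖t⁻¹ • u n - y + (d (u n) - t • d y)‖ := fun n => by
      have hsa : IsSelfAdjoint (t⁻¹ • u n - y) :=
        ((IsSelfAdjoint.all t⁻¹).smul (hu n)).sub hy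
      have := (hd.smul (t : ℂ)).norm_le_norm_add hsa
      convert this using 3
      simp only [LinearMap.smul_apply, map_sub, LinearMap.map_smul_of_tower,
        Complex.coe_smul, smul_smul, mul_inv_cancel₀ ht.ne', one_smul]
    have h2 : Tendsto (fun n => ‖t⁻¹ • u n - y‖) atTop (𝓝 ‖t⁻¹ • (0 : A) - y‖) :=
      ((hu0.const_smul _).sub_const _).norm
    have h3 : Tendsto (fun n => ‖t⁻¹ • u n - y + (d (u n) - t • d y)‖) atTop
        (𝓝 ‖t⁻¹ • (0 : A) - y + (y - t • d y)‖) :=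
      (((hu0.const_smul _).sub_const _).add (huy.sub_const _)).norm
    have := le_of_tendsto_of_tendsto' h2 h3 h1
    rwa [smul_zero, zero_sub, norm_neg, ← add_sub_assoc, neg_add_cancel, zero_sub, norm_neg, norm_smul,
      Real.norm_of_nonneg ht.le] at this
  have hlim : Tendsto (fun t : ℝ => t * ‖d y‖) (𝓝[>] 0) (𝓝 0) := by
    have : Continuous (fun t : ℝ => t * ‖d y‖) := by fun_prop
    simpa using (this.tendsto 0).mono_left nhdsWithin_le_nhds
  have : ‖y‖ ≤ 0 := ge_of_tendsto hlim (by filter_upwards [self_mem_nhdsWithin] with t ht using key t ht)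
  simpa using this

/-- The adjoint `x ↦ (d x⋆)⋆` of a linear map between star modules. -/
def LinearMap.starConj (d : A →ₗ[ℂ] A) : A →ₗ[ℂ] A where
  toFun x := star (d (star x))
  map_add' x y := by simp
  map_smul' z x := by simp

theorem LinearMap.starConj_apply (d : A →ₗ[ℂ] A) (x : A) : d.starConj x = star (d (star x)) := rfl

theorem IsAlgDerivation.starConj {d : A →ₗ[ℂ] A} (hd : IsAlgDerivation d) :
    IsAlgDerivation d.starConj := fun a b => by
  simp only [LinearMap.starConj_apply, star_mul, hd (star b) (star a), star_add, star_star]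
  abel

open Filter Topology in
/-- A derivation commuting with the involution is continuous. -/
theorem IsAlgDerivation.continuous_of_map_star {d : A →ₗ[ℂ] A} (hd : IsAlgDerivation d)
    (hs : ∀ x, d (star x) = star (d x)) : Continuous d := by
  have hsa : ∀ u : ℕ → A, Tendsto u atTop (𝓝 0) → ∀ y, Tendsto (fun n => d (u n)) atTop (𝓝 y) →
      y + star y = 0 := by
    intro u hu y huy
    refine hd.eq_zero_of_tendsto (u := fun n => u n + star (u n))
      (fun n => IsSelfAdjoint.add_star_self _) ?_ (IsSelfAdjoint.add_star_self _) ?_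
    · simpa using hu.add hu.star
    · simpa only [map_add, hs] using huy.add huy.star
  have hzero : ∀ u : ℕ → A, Tendsto u atTop (𝓝 0) → ∀ y, Tendsto (fun n => d (u n)) atTop (𝓝 y) →
      y = 0 := by
    intro u hu y huy
    have h1 := hsa u hu y huy
    -- Rotating by `I` turns the vanishing of the real part of `y` into that of its imaginary part.
    have h2 := hsa (fun n => Complex.I • u n) (by simpa using hu.const_smul Complex.I)
      (Complex.I • y) (by simpa only [map_smul] using huy.const_smul Complex.I)
    have h3 : Complex.I • (y - star y) = 0 := by
      rw [← h2, smul_sub, star_smul, Complex.star_def, Complex.conj_I, neg_smul, sub_eq_add_neg]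
    have h4 : y - star y = 0 := (smul_eq_zero.1 h3).resolve_left Complex.I_ne_zero
    have h5 : (2 : ℂ) • y = 0 := by
      rw [two_smul]
      calc y + y = (y + star y) + (y - star y) := by abel
        _ = 0 := by rw [h1, h4, add_zero]
    exact (smul_eq_zero.1 h5).resolve_left two_ne_zero
  refine d.continuous_of_seq_closed_graph fun u x y hu huy => ?_
  refine sub_eq_zero.1 (hzero (fun n => u n - x) (by simpa using hu.sub_const x) _ ?_)
  simpa only [map_sub, Function.comp_apply] using huy.sub_const (d x)

/-- **Sakai's theorem**: every derivation of a C⋆-algebra is continuous. -/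
theorem IsAlgDerivation.continuous {d : A →ₗ[ℂ] A} (hd : IsAlgDerivation d) : Continuous d := by
  have h1 : Continuous (d + d.starConj) :=
    (hd.add hd.starConj).continuous_of_map_star fun x => by
      simp [LinearMap.starConj_apply, add_comm]
  have h2 : Continuous (Complex.I • d + (-Complex.I) • d.starConj) :=
    ((hd.smul _).add (hd.starConj.smul _)).continuous_of_map_star fun x => by
      simp [LinearMap.starConj_apply, add_comm]
  have h3 : ∀ x, d x = (1 / 2 : ℂ) • ((d + d.starConj) x -
      Complex.I • (Complex.I • d + (-Complex.I) • d.starConj) x) := fun x => by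
    simp only [LinearMap.add_apply, LinearMap.smul_apply, smul_add, smul_sub, smul_smul]
    simp only [mul_neg, Complex.I_mul_I]
    module
  rw [show (d : A → A) = _ from funext h3]
  exact (h1.sub (h2.const_smul _)).const_smul _

end Derivation

/-! ### Right module maps are bounded -/

section RightModuleMap

variable {A : Type*} [NonUnitalCStarAlgebra A] [PartialOrder A] [StarOrderedRing A]

/-- If `x x⋆ ≤ s`, then `‖f(s) x‖` is controlled by `|f(t)|² t` on the quasispectrum of `s`. -/
theorem norm_cfcₙ_mul_le {s x : A} (hs : 0 ≤ s) (hx : x * star x ≤ s) {f : ℝ → ℝ}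
    (hf : Continuous f) (hf0 : f 0 = 0) {c : ℝ} (hc : 0 ≤ c)
    (hb : ∀ t ∈ quasispectrum ℝ s, |f t * t * f t| ≤ c ^ 2) : ‖cfcₙ f s * x‖ ≤ c := by
  have hsa : IsSelfAdjoint s := .of_nonneg hs
  set g := cfcₙ f s with hg
  have hgsa : IsSelfAdjoint g := cfcₙ_predicate f s
  have h1 : g * x * star (g * x) = g * (x * star x) * g := by
    rw [star_mul, hgsa.star_eq]; simp only [mul_assoc]
  have h2 : g * s * g = cfcₙ (fun t => f t * t * f t) s := by
    rw [cfcₙ_mul (fun t => f t * t) f s, cfcₙ_mul f (fun t => t) s, cfcₙ_id' ℝ s]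
  have h3 : ‖g * x‖ ^ 2 ≤ c ^ 2 := by
    rw [sq, ← CStarRing.norm_self_mul_star, h1]
    calc ‖g * (x * star x) * g‖ ≤ ‖g * s * g‖ := by
          refine CStarAlgebra.norm_le_norm_of_nonneg_of_le ?_ (hgsa.conjugate_le_conjugate hx)
          rw [← h1]; exact mul_star_self_nonneg _
      _ ≤ c ^ 2 := by
          rw [h2]; exact norm_cfcₙ_le fun t ht => hb t ht
  exact le_of_sq_le_sq h3 hc

/-- If `x x⋆ ≤ s`, then `‖f(s) x - x‖` is controlled by `|f(t) - 1|² t` on the quasispectrum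
of `s`. -/
theorem norm_cfcₙ_mul_sub_le {s x : A} (hs : 0 ≤ s) (hx : x * star x ≤ s) {f : ℝ → ℝ}
    (hf : Continuous f) (hf0 : f 0 = 0) {c : ℝ} (hc : 0 ≤ c)
    (hb : ∀ t ∈ quasispectrum ℝ s, |(f t - 1) * t * (f t - 1)| ≤ c ^ 2) :
    ‖cfcₙ f s * x - x‖ ≤ c := by
  have hsa : IsSelfAdjoint s := .of_nonneg hs
  set g := cfcₙ f s with hg
  have hgsa : IsSelfAdjoint g := cfcₙ_predicate f s
  have h1 : ∀ y : A, (g * y - y) * star (g * y - y) =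
      g * (y * star y) * g - g * (y * star y) - (y * star y) * g + y * star y := fun y => by
    rw [star_sub, star_mul, hgsa.star_eq]; noncomm_ring
  have h2 : g * s * g - g * s - s * g + s = cfcₙ (fun t => (f t - 1) * t * (f t - 1)) s := by
    have e1 : g * s = cfcₙ (fun t => f t * t) s := by
      rw [cfcₙ_mul f (fun t => t) s, cfcₙ_id' ℝ s]
    have e2 : s * g = cfcₙ (fun t => t * f t) s := by
      rw [cfcₙ_mul (fun t => t) f s, cfcₙ_id' ℝ s]
    have e3 : g * s * g = cfcₙ (fun t => f t * t * f t) s := by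
      rw [e1, cfcₙ_mul (fun t => f t * t) f s]
    rw [e3, e1, e2]
    conv_lhs => rw [← cfcₙ_sub _ _ s, ← cfcₙ_sub _ _ s]
    nth_rewrite 2 [← cfcₙ_id' ℝ s]
    rw [← cfcₙ_add _ _ s]
    exact cfcₙ_congr fun t _ => by ring
  -- Conjugation by `g - 1` preserves order, but `1` is not in `A`; writing `s - x * star x = a *
  -- star a` exhibits the difference as a square.
  obtain ⟨a, ha⟩ := CStarAlgebra.nonneg_iff_eq_mul_star_self.1 (sub_nonneg.2 hx)
  have h3 : (g * x - x) * star (g * x - x) ≤ g * s * g - g * s - s * g + s := by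
    have : g * s * g - g * s - s * g + s =
        (g * x - x) * star (g * x - x) + (g * a - a) * star (g * a - a) := by
      rw [h1, h1, ← ha]; noncomm_ring
    rw [this]
    exact le_add_of_nonneg_right (mul_star_self_nonneg _)
  have h4 : ‖g * x - x‖ ^ 2 ≤ c ^ 2 := by
    rw [sq, ← CStarRing.norm_self_mul_star]
    refine (CStarAlgebra.norm_le_norm_of_nonneg_of_le (mul_star_self_nonneg _) h3).trans ?_
    rw [h2]
    exact norm_cfcₙ_le fun t ht => hb t ht
  exact le_of_sq_le_sq h4 hc

/-- `r ^ 5 / (r ^ 4 + σ ^ 4)` approximates `r` from below within `σ`. -/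
theorem sq_mul_cube_div_mem_Icc {r σ : ℝ} (hr : 0 ≤ r) (hσ : 0 < σ) :
    r ^ 2 * (r ^ 3 / (r ^ 4 + σ ^ 4)) ∈ Set.Icc (r - σ) r := by
  have hden : 0 < r ^ 4 + σ ^ 4 := by positivity
  rw [← mul_div_assoc, Set.mem_Icc, le_div_iff₀ hden, div_le_iff₀ hden]
  refine ⟨?_, ?_⟩
  · have : r * σ ^ 3 ≤ r ^ 4 + σ ^ 4 := by
      rcases le_total r σ with h | h
      · calc r * σ ^ 3 ≤ σ * σ ^ 3 := by gcongr
          _ ≤ _ := by nlinarith [pow_nonneg hr 4]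
      · calc r * σ ^ 3 ≤ r * r ^ 3 := by gcongr
          _ ≤ _ := by nlinarith [pow_pos hσ 4]
    nlinarith [mul_le_mul_of_nonneg_left this hσ.le]
  · have : 0 ≤ r * σ ^ 4 := by positivity
    nlinarith

open Filter Topology in
/-- If `x x⋆ ≤ s`, then `x` is divisible on the left by the fourth root of `s`, with quotient
bounded in terms of `s` only. -/
theorem exists_eq_cfcₙ_sqrt_sqrt_mul {s x : A} (hs : 0 ≤ s) (hx : x * star x ≤ s) :
    ∃ c : A, x = cfcₙ (fun t : ℝ => √√t) s * c ∧ ‖c‖ ≤ √√‖s‖ := by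
  have hsa : IsSelfAdjoint s := .of_nonneg hs
  have hnn : ∀ t ∈ quasispectrum ℝ s, 0 ≤ t := fun t ht => quasispectrum_nonneg_of_nonneg s hs t ht
  have hle : ∀ t ∈ quasispectrum ℝ s, t ≤ ‖s‖ := fun t ht =>
    (le_abs_self t).trans
      (NonUnitalIsometricContinuousFunctionalCalculus.norm_quasispectrum_le s ht hsa)
  set q : ℝ → ℝ := fun t => √√t with hq
  have hqc : Continuous q := by fun_prop
  have hq0 : q 0 = 0 := by simp [hq]
  have hqnn : ∀ t, 0 ≤ q t := fun t => Real.sqrt_nonneg _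
  have hq4 : ∀ t, 0 ≤ t → q t ^ 4 = t := fun t ht => by
    rw [show (4 : ℕ) = 2 * 2 from rfl, pow_mul, Real.sq_sqrt (Real.sqrt_nonneg t), Real.sq_sqrt ht]
  -- A regularization of `1 / q` vanishing at `0`. The quotient is the limit of `F σ (s) * x` along
  -- `σ = 2⁻ⁿ`; the norm estimates only see `√t * F σ t = q t ^ 2 * F σ t`, which is within `σ` of
  -- `q t`.
  set F : ℝ → ℝ → ℝ := fun σ t => q t ^ 3 / (q t ^ 4 + σ ^ 4) with hF
  have hden : ∀ t σ, 0 < σ → 0 < q t ^ 4 + σ ^ 4 := fun t σ hσ => by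
    have := hqnn t; positivity
  have hFc : ∀ σ, 0 < σ → Continuous (F σ) := fun σ hσ =>
    (hqc.pow 3).div₀ ((hqc.pow 4).add continuous_const) fun t => (hden t σ hσ).ne'
  have hF0 : ∀ σ, F σ 0 = 0 := fun σ => by simp [hF, hq0]
  set C : ℕ → A := fun n => cfcₙ (F ((1 / 2) ^ n)) s * x with hC
  have hpos : ∀ n : ℕ, (0 : ℝ) < (1 / 2) ^ n := fun n => by positivity
  have hdist : ∀ n, dist (C n) (C (n + 1)) ≤ 1 * (1 / 2) ^ n := by
    intro n
    have hc1 := hFc _ (hpos n)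
    have hc2 := hFc _ (hpos (n + 1))
    have h01 := hF0 ((1 / 2) ^ n)
    have h02 := hF0 ((1 / 2) ^ (n + 1))
    rw [dist_eq_norm, hC]
    simp only
    rw [← sub_mul, ← cfcₙ_sub _ _ s hc1.continuousOn h01 hc2.continuousOn h02, one_mul]
    refine norm_cfcₙ_mul_le hs hx (hc1.sub hc2) (sub_eq_zero.2 (h01.trans h02.symm)) (hpos n).le fun t ht => ?_
    have g1 := sq_mul_cube_div_mem_Icc (hqnn t) (hpos n)
    have g2 := sq_mul_cube_div_mem_Icc (hqnn t) (hpos (n + 1))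
    have hmono : (1 / 2 : ℝ) ^ (n + 1) ≤ (1 / 2) ^ n :=
      pow_le_pow_of_le_one (by norm_num) (by norm_num) n.le_succ
    have heq : (F ((1 / 2) ^ n) t - F ((1 / 2) ^ (n + 1)) t) * t *
        (F ((1 / 2) ^ n) t - F ((1 / 2) ^ (n + 1)) t) =
        (q t ^ 2 * F ((1 / 2) ^ n) t - q t ^ 2 * F ((1 / 2) ^ (n + 1)) t) ^ 2 := by
      linear_combination
        -(F ((1 / 2) ^ n) t - F ((1 / 2) ^ (n + 1)) t) ^ 2 * hq4 t (hnn t ht)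
    refine ((congrArg abs heq).trans (abs_of_nonneg (sq_nonneg _))).trans_le ?_
    refine sq_le_sq' ?_ ?_ <;> linarith [g1.1, g1.2, g2.1, g2.2]
  obtain ⟨c, hc⟩ := cauchySeq_tendsto_of_complete
    (cauchySeq_of_le_geometric (1 / 2) 1 (by norm_num) hdist)
  refine ⟨c, ?_, ?_⟩
  · refine tendsto_nhds_unique (f := fun n => cfcₙ q s * C n) (l := atTop) ?_ (hc.const_mul _)
    rw [tendsto_iff_norm_sub_tendsto_zero]
    have hz : Tendsto (fun n : ℕ => (1 / 2 : ℝ) ^ n * √√‖s‖) atTop (𝓝 0) := by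
      simpa using (tendsto_pow_atTop_nhds_zero_of_lt_one (r := (1 / 2 : ℝ)) (by norm_num)
        (by norm_num)).mul_const (√√‖s‖)
    refine squeeze_zero (fun _ => norm_nonneg _) (fun n => ?_) hz
    have hFn := hFc _ (hpos n)
    have hFn0 := hF0 ((1 / 2) ^ n)
    rw [hC]
    simp only
    rw [← mul_assoc, ← cfcₙ_mul q _ s hqc.continuousOn hq0 hFn.continuousOn hFn0]
    refine norm_cfcₙ_mul_sub_le hs hx (hqc.mul hFn) (by simp [hq0])
      (mul_nonneg (hpos n).le (Real.sqrt_nonneg _)) fun t ht => ?_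
    have g1 := sq_mul_cube_div_mem_Icc (hqnn t) (hpos n)
    have heq : (q t * F ((1 / 2) ^ n) t - 1) * t * (q t * F ((1 / 2) ^ n) t - 1) =
        ((q t - q t ^ 2 * F ((1 / 2) ^ n) t) * q t) ^ 2 := by
      linear_combination -(q t * F ((1 / 2) ^ n) t - 1) ^ 2 * hq4 t (hnn t ht)
    refine ((congrArg abs heq).trans (abs_of_nonneg (sq_nonneg _))).trans_le ?_
    refine pow_le_pow_left₀ (mul_nonneg (sub_nonneg.2 g1.2) (hqnn t)) ?_ 2
    exact mul_le_mul (by linarith [g1.1]) (Real.sqrt_le_sqrt (Real.sqrt_le_sqrt (hle t ht)))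
      (hqnn t) (hpos n).le
  · refine le_of_tendsto' hc.norm fun n => ?_
    refine norm_cfcₙ_mul_le hs hx (hFc _ (hpos n)) (hF0 _) (Real.sqrt_nonneg _) fun t ht => ?_
    have g1 := sq_mul_cube_div_mem_Icc (hqnn t) (hpos n)
    have heq : F ((1 / 2) ^ n) t * t * F ((1 / 2) ^ n) t =
        (q t ^ 2 * F ((1 / 2) ^ n) t) ^ 2 := by
      linear_combination -(F ((1 / 2) ^ n) t ^ 2) * hq4 t (hnn t ht)
    have hFnn : 0 ≤ F ((1 / 2) ^ n) t := div_nonneg (pow_nonneg (hqnn t) 3) (hden t _ (hpos n)).le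
    refine ((congrArg abs heq).trans (abs_of_nonneg (sq_nonneg _))).trans_le ?_
    exact pow_le_pow_left₀ (mul_nonneg (sq_nonneg _) hFnn)
      (g1.2.trans (Real.sqrt_le_sqrt (Real.sqrt_le_sqrt (hle t ht)))) 2

/-- A linear map commuting with right multiplications of a C⋆-algebra is bounded. -/
theorem LinearMap.exists_bound_of_map_mul (T : A →ₗ[ℂ] A) (hT : ∀ x a, T (x * a) = T x * a) :
    ∃ C, ∀ x, ‖T x‖ ≤ C * ‖x‖ := by
  by_contra! hcon
  have hex : ∀ n : ℕ, ∃ x : A, ‖x‖ = (1 / 2) ^ n ∧ (n : ℝ) ≤ ‖T x‖ := by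
    intro n
    obtain ⟨x, hx⟩ := hcon (n * 2 ^ n)
    have hx0 : 0 < ‖x‖ := norm_pos_iff.2 fun h => by simp [h] at hx
    refine ⟨((1 / 2) ^ n * ‖x‖⁻¹ : ℝ) • x, ?_, ?_⟩
    · rw [norm_smul, Real.norm_of_nonneg (by positivity), mul_assoc, inv_mul_cancel₀ hx0.ne',
        mul_one]
    · rw [LinearMap.map_smul_of_tower, norm_smul, Real.norm_of_nonneg (by positivity)]
      calc (n : ℝ) = (1 / 2) ^ n * ‖x‖⁻¹ * (n * 2 ^ n * ‖x‖) := by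
            have : ((1 / 2 : ℝ) ^ n) * 2 ^ n = 1 := by rw [← mul_pow]; norm_num
            calc (n : ℝ) = n * ((1 / 2 : ℝ) ^ n * 2 ^ n) * (‖x‖⁻¹ * ‖x‖) := by
                  rw [this, inv_mul_cancel₀ hx0.ne', mul_one, mul_one]
              _ = _ := by ring
        _ ≤ _ := by gcongr
  choose u hu hTu using hex
  -- One element `s` dominates every `u n * star (u n)`, so its fourth root is a common left factor
  -- of all `u n`.
  have hsum : Summable fun n => u n * star (u n) := by
    refine Summable.of_norm_bounded (g := fun n : ℕ => (1 / 4 : ℝ) ^ n)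
      (summable_geometric_of_lt_one (by norm_num) (by norm_num)) fun n => ?_
    rw [CStarRing.norm_self_mul_star, hu, ← mul_pow]
    norm_num
  set s := ∑' n, u n * star (u n) with hs
  have hs0 : 0 ≤ s := tsum_nonneg fun n => mul_star_self_nonneg _
  have hle : ∀ n, u n * star (u n) ≤ s := fun n =>
    hsum.le_tsum n fun m _ => mul_star_self_nonneg _
  set b := cfcₙ (fun t : ℝ => √√t) s with hb
  obtain ⟨n, hn⟩ := exists_nat_gt (‖T b‖ * √√‖s‖)
  obtain ⟨c, hc, hcn⟩ := exists_eq_cfcₙ_sqrt_sqrt_mul hs0 (hle n)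
  have : ‖T (u n)‖ ≤ ‖T b‖ * √√‖s‖ := by
    rw [hc, hT]
    exact (norm_mul_le _ _).trans (by gcongr)
  linarith [hTu n]

end RightModuleMap

theorem corollary2p3 {A : Type*} [NonUnitalCStarAlgebra A] (δ : A →ₗ[ℂ] A)
    (hδ : IsGeneralizedDerivation A δ) : IsBoundedLinearMap ℂ δ := by
  -- The order serves only the factorization argument, so it is chosen here.
  let _ := CStarAlgebra.spectralOrder A
  have _ := CStarAlgebra.spectralOrderedRing A
  obtain ⟨d, hd, h⟩ := (isGeneralizedDerivation_self_iff δ).1 hδ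
  obtain ⟨C, hC⟩ := (δ - d).exists_bound_of_map_mul fun x a => by
    rw [LinearMap.sub_apply, LinearMap.sub_apply, h, hd, sub_mul]
    abel
  let D : A →L[ℂ] A := ⟨d, IsAlgDerivation.continuous hd⟩
  have h1 : IsBoundedLinearMap ℂ (δ - d) := (δ - d).isLinear.with_bound C hC
  have h2 : IsBoundedLinearMap ℂ d := D.isBoundedLinearMap
  simpa using h1.add h2
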